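/- All groups are finite. A complex character $\chi$ of a group $N$ is multiplicity free if $\langle\chi,\mu\rangle=\frac{1}{|N|}\sum_{n\in N}\chi(n)\overline{\mu(n)}\le 1$ for every irreducible complex character $\mu$ of $N$; a complex representation is multiplicity free if its character is. A group $G$ is unramified over a nontrivial abelian normal subgroup $N$ if for every irreducible complex linear representation $\rho$ of $G$ the restriction $\rho|_N$ is multiplicity free or trivial (i.e. $\rho(n)=\mathrm{id}$ for all $n\in N$). A group $G$ is totally unramified if it is abelian or if, recursively, it has a nontrivial abelian normal subgroup $N$ such that $G$ is unramified over $N$ and $G/N$ is totally unramified. Let $A$ and $B$ be finite abelian groups and let $G=A\rtimes_\varphi B$ be the semidirect product for a homomorphism $\varphi\colon B\to\operatorname{Aut}(A)$. Then $G$ is totally unramified. Moreover, if $A$ is nontrivial, then $G$ is unramified over $A$. -/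

import Mathlib

universe u

noncomputable section

/-- The scalar product `⟨φ, ψ⟩ = |G|⁻¹ ∑ g, φ g * conj (ψ g)` of complex valued functions on a
finite group. -/
def classInner {G : Type u} [Group G] [Finite G] (φ ψ : G → ℂ) : ℂ :=
  (Nat.card G : ℂ)⁻¹ * ∑ᶠ g : G, φ g * (starRingEnd ℂ) (ψ g)

/-- `μ` is the character of an irreducible complex linear representation of the finite group `G`.
Up to equivalence every finite-dimensional complex representation lives on a space in `Type`. -/
def IsIrreducibleCharacter {G : Type u} [Group G] [Finite G] (μ : G → ℂ) : Prop :=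
  ∃ (V : Type) (_ : AddCommGroup V) (_ : Module ℂ V) (_ : FiniteDimensional ℂ V)
    (ρ : Representation ℂ G V), ρ.IsIrreducible ∧ ρ.character = μ

open scoped ComplexOrder in
/-- A complex character `χ` is multiplicity free if `⟨χ, μ⟩ ≤ 1` for every irreducible
character `μ`. -/
def IsMultiplicityFreeCharacter {G : Type u} [Group G] [Finite G] (χ : G → ℂ) : Prop :=
  ∀ μ : G → ℂ, IsIrreducibleCharacter μ → classInner χ μ ≤ 1

/-- A complex representation is multiplicity free if its character is. -/
def IsMultiplicityFree {G : Type u} [Group G] [Finite G] {V : Type} [AddCommGroup V] [Module ℂ V]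
    [FiniteDimensional ℂ V] (ρ : Representation ℂ G V) : Prop :=
  IsMultiplicityFreeCharacter ρ.character

/-- The restriction of a representation of `G` to a subgroup `N`. -/
abbrev restrictRep {G : Type u} [Group G] (N : Subgroup G) {V : Type} [AddCommGroup V]
    [Module ℂ V] (ρ : Representation ℂ G V) : Representation ℂ N V :=
  ρ.comp N.subtype

/-- The finite group `G` is unramified over the subgroup `N`: `N` is a nontrivial abelian normal
subgroup, and the restriction to `N` of every irreducible complex linear representation of `G` is
multiplicity free or trivial (that is, `N` acts as the identity). -/
structure IsUnramifiedOver (G : Type u) [Group G] [Finite G] (N : Subgroup G) : Prop where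
  ne_bot : N ≠ ⊥
  normal : N.Normal
  comm : ∀ a ∈ N, ∀ b ∈ N, a * b = b * a
  restrict : ∀ (V : Type) [AddCommGroup V] [Module ℂ V] [FiniteDimensional ℂ V]
    (ρ : Representation ℂ G V), ρ.IsIrreducible →
      IsMultiplicityFree (restrictRep N ρ) ∨ (restrictRep N ρ).IsTrivial

/-- The finite group `G` is totally unramified if it is abelian, or it is unramified over some
(nontrivial abelian normal) subgroup `N` such that `G ⧸ N` is totally unramified. -/
inductive IsTotallyUnramified : (G : Type u) → [Group G] → [Finite G] → Prop
  | of_comm (G : Type u) [Group G] [Finite G] (h : ∀ a b : G, a * b = b * a) :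
      IsTotallyUnramified G
  | of_quotient (G : Type u) [Group G] [Finite G] (N : Subgroup G) [N.Normal]
      (hN : IsUnramifiedOver G N) (hq : IsTotallyUnramified (G ⧸ N)) :
      IsTotallyUnramified G

instance SemidirectProduct.instFiniteOfFinite {A B : Type*} [Group A] [Group B] [Finite A]
    [Finite B] (φ : B →* MulAut A) : Finite (A ⋊[φ] B) :=
  Finite.of_equiv (A × B) SemidirectProduct.equivProd.symm

end

/-! This is Clifford theory done by hand. Let `V` be irreducible for `G = NH` with `H` abelian, and
let `E` be the `l`-isotypic part of `V` under `N`. The elements of `H` stabilizing `E` commute, so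
if `E ≠ 0` they share an eigenvector `v` in `E`. Irreducibility makes the translates `ρ h v` span
`V`. Each is an `N`-eigenvector for a conjugate of `l`, so the projection onto `E` kills it unless
`h` stabilizes `E`, and then it is a multiple of `v`. Hence `dim E ≤ 1`. This dimension is the
multiplicity of `l`, and irreducible characters of abelian `N` are linear. For `A ⋊ B`, take `N =
A`, `H = B`; the quotient by `A` is abelian. -/

/-- Commuting endomorphisms of a nonzero finite-dimensional complex vector space have a common
eigenvector in every nonzero common invariant subspace. -/
theorem exists_common_eigenvector {V ι : Type*} [AddCommGroup V] [Module ℂ V]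
    [FiniteDimensional ℂ V] (f : ι → Module.End ℂ V) (hf : ∀ i j, Commute (f i) (f j))
    (U : Submodule ℂ V) (hU : U ≠ ⊥) (hfU : ∀ i, ∀ v ∈ U, f i v ∈ U) :
    ∃ v ∈ U, v ≠ 0 ∧ ∀ i, ∃ c : ℂ, f i v = c • v := by
  obtain ⟨W, ⟨hWU, hW, hfW⟩, hmin⟩ := (wellFounded_lt (α := Submodule ℂ V)).has_min
    {W | W ≤ U ∧ W ≠ ⊥ ∧ ∀ i, ∀ v ∈ W, f i v ∈ W} ⟨U, le_rfl, hU, hfU⟩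
  obtain ⟨v, hvW, hv⟩ := W.exists_mem_ne_zero_of_ne_bot hW
  refine ⟨v, hWU hvW, hv, fun i ↦ ?_⟩
  have : Nontrivial W := Submodule.nontrivial_iff_ne_bot.mpr hW
  obtain ⟨c, hc⟩ := Module.End.exists_eigenvalue ((f i).restrict (hfW i))
  obtain ⟨w, hw⟩ := hc.exists_hasEigenvector
  have hwe : f i w = c • (w : V) := by simpa using congrArg Subtype.val hw.apply_eq_smul
  refine ⟨c, ?_⟩
  by_contra hne
  -- By commutation the eigenspace is invariant, so minimality of `W` forces it to contain `W`.
  refine hmin (W ⊓ (f i).eigenspace c) ⟨inf_le_left.trans hWU, ?_, fun j u hu ↦ ?_⟩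
    (inf_le_left.lt_of_ne fun h ↦ hne ?_)
  · refine (Submodule.ne_bot_iff _).mpr ⟨w, ⟨w.2, Module.End.mem_eigenspace_iff.mpr hwe⟩, ?_⟩
    simpa using hw.2
  · refine ⟨hfW j u hu.1, Module.End.mem_eigenspace_iff.mpr ?_⟩
    have h := LinearMap.congr_fun (hf i j) u
    simp only [Module.End.mul_apply] at h
    rw [h, Module.End.mem_eigenspace_iff.mp hu.2, map_smul]
  · exact Module.End.mem_eigenspace_iff.mp (h.ge hvW).2

namespace Representation

/-- A nonzero invariant subspace of an irreducible representation is the whole space. -/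
theorem IsIrreducible.eq_top_of_forall_mem {k G V : Type*} [Field k] [Monoid G] [AddCommGroup V]
    [Module k V] {ρ : Representation k G V} (hρ : ρ.IsIrreducible) (W : Submodule k V)
    (hW : W ≠ ⊥) (h : ∀ g, ∀ v ∈ W, ρ g v ∈ W) : W = ⊤ := by
  have := hρ
  rcases eq_bot_or_eq_top (⟨W, fun g v hv ↦ h g v hv⟩ : Subrepresentation ρ) with h | h
  · exact absurd (congrArg Subrepresentation.toSubmodule h) hW
  · exact congrArg Subrepresentation.toSubmodule h

/-- The twist of a representation by the inverse of a linear character. -/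
def twistInv {G V : Type*} [Group G] [AddCommGroup V] [Module ℂ V]
    (ρ : Representation ℂ G V) (l : G →* ℂˣ) : Representation ℂ G V where
  toFun g := ((l g)⁻¹ : ℂˣ) • ρ g
  map_one' := by simp
  map_mul' g h := by
    ext v
    simp [mul_smul, smul_comm (l g)⁻¹ (l h)⁻¹, mul_comm]

theorem twistInv_apply {G V : Type*} [Group G] [AddCommGroup V] [Module ℂ V]
    (ρ : Representation ℂ G V) (l : G →* ℂˣ) (g : G) (v : V) :
    ρ.twistInv l g v = (l g)⁻¹ • ρ g v := rfl

theorem mem_invariants_twistInv {G V : Type*} [Group G] [AddCommGroup V] [Module ℂ V]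
    {ρ : Representation ℂ G V} {l : G →* ℂˣ} {v : V} :
    v ∈ (ρ.twistInv l).invariants ↔ ∀ g, ρ g v = (l g : ℂ) • v := by
  simp only [mem_invariants, twistInv_apply, inv_smul_eq_iff]
  rfl

theorem averageMap_eq_sum {G V : Type*} [Group G] [Fintype G] [AddCommGroup V] [Module ℂ V]
    [Invertible (Fintype.card G : ℂ)] (ρ : Representation ℂ G V) :
    ρ.averageMap = (Fintype.card G : ℂ)⁻¹ • ∑ g, ρ g := by
  simp [averageMap, GroupAlgebra.average, map_sum]

/-- If `G` is the product of a normal subgroup `N` and a commutative subgroup `H`, then every linear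
character of `N` has multiplicity at most one in an irreducible representation of `G`. -/
theorem IsIrreducible.finrank_invariants_twistInv_le_one {G V : Type*} [Group G] [AddCommGroup V]
    [Module ℂ V] [FiniteDimensional ℂ V] {ρ : Representation ℂ G V} (hρ : ρ.IsIrreducible)
    (N H : Subgroup G) [hN : N.Normal] [Finite N] (hH : ∀ a ∈ H, ∀ b ∈ H, a * b = b * a)
    (hNH : ∀ g : G, ∃ n ∈ N, ∃ h ∈ H, g = n * h) (l : N →* ℂˣ) :
    Module.finrank ℂ (twistInv (ρ.comp N.subtype) l).invariants ≤ 1 := by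
  have := Fintype.ofFinite N
  have : Invertible (Fintype.card N : ℂ) := invertibleOfNonzero (by simp)
  set E := (twistInv (ρ.comp N.subtype) l).invariants
  have hmem (v : V) : v ∈ E ↔ ∀ n : N, ρ n v = (l n : ℂ) • v := mem_invariants_twistInv
  by_cases hbot : E = ⊥
  · rw [hbot, finrank_bot]
    exact zero_le_one
  -- Only the stabilizer of `E` in `H` acts on `E`; the rest of `H` moves `E` to other isotypic
  -- parts.
  obtain ⟨v, hvE, hv, hvc⟩ := exists_common_eigenvector
    (fun h : {h : H // ∀ v ∈ E, ρ h v ∈ E} ↦ ρ (h.1 : G))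
    (fun a b ↦ by
      rw [Commute, SemiconjBy, ← map_mul, ← map_mul, hH _ a.1.2 _ b.1.2])
    E hbot (fun i ↦ i.2)
  have hconj (n : N) (h : G) (u : V) (hu : u ∈ E) :
      ρ n (ρ h u) = (l ⟨h⁻¹ * n * h, hN.conj_mem' _ n.2 h⟩ : ℂ) • ρ h u := by
    have h1 := (hmem u).1 hu ⟨h⁻¹ * n * h, hN.conj_mem' _ n.2 h⟩
    rw [← map_smul, ← h1, ← Module.End.mul_apply, ← Module.End.mul_apply, ← map_mul, ← map_mul]
    congr 2
    group
  have hspan : Submodule.span ℂ (Set.range fun h : H ↦ ρ h v) = ⊤ := by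
    refine hρ.eq_top_of_forall_mem _ ?_ fun g u hu ↦ ?_
    · refine (Submodule.ne_bot_iff _).mpr ⟨v, Submodule.subset_span ⟨1, by simp⟩, hv⟩
    · obtain ⟨n, hn, h, hh, rfl⟩ := hNH g
      refine (Submodule.span_le (p := (Submodule.span ℂ _).comap (ρ (n * h)))).mpr ?_ hu
      rintro _ ⟨k, rfl⟩
      have h1 := hconj ⟨n, hn⟩ (h * k) v hvE
      simp only [SetLike.mem_coe, Submodule.mem_comap]
      rw [← Module.End.mul_apply, ← map_mul, mul_assoc, map_mul, Module.End.mul_apply]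
      exact h1 ▸ Submodule.smul_mem _ _ (Submodule.subset_span ⟨⟨h, hh⟩ * k, rfl⟩)
  have hproj := (twistInv (ρ.comp N.subtype) l).isProj_averageMap
  set P := (twistInv (ρ.comp N.subtype) l).averageMap with hP
  have hPspan : ∀ u, P u ∈ Submodule.span ℂ {v} := by
    intro u
    refine (Submodule.span_le (p := (Submodule.span ℂ {v}).comap P)).mpr ?_
      (hspan.ge (Submodule.mem_top (x := u)))
    rintro _ ⟨h, rfl⟩
    simp only [SetLike.mem_coe, Submodule.mem_comap]
    obtain ⟨c, hc⟩ : ∃ c : ℂ, P (ρ h v) = c • ρ h v := by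
      refine ⟨(Fintype.card N : ℂ)⁻¹ * ∑ n : N, ((l n)⁻¹ : ℂˣ) *
        (l ⟨(h : G)⁻¹ * n * h, hN.conj_mem' _ n.2 h⟩ : ℂ), ?_⟩
      rw [hP, averageMap_eq_sum, LinearMap.smul_apply, LinearMap.sum_apply, mul_smul,
        Finset.sum_smul]
      congr 1
      refine Finset.sum_congr rfl fun n _ ↦ ?_
      rw [twistInv_apply, mul_smul, ← hconj n h v hvE]
      rfl
    -- No orthogonality of characters is needed: if `c ≠ 0`, then `ρ h v` lies in the image `E` of
    -- `P`.
    by_cases hc0 : c = 0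
    · simp [hc, hc0]
    have hhE : ρ h v ∈ E := by
      have h1 := hproj.map_mem (ρ h v)
      rw [hc] at h1
      exact (Submodule.smul_mem_iff _ hc0).mp h1
    have hhv : ρ h v ≠ 0 := fun h0 ↦ hv <| by
      have h1 := congrArg (ρ (h : G)⁻¹) h0
      simpa using h1
    have hst (w : V) (hw : w ∈ E) : ρ h w ∈ E := by
      refine (hmem _).mpr fun n ↦ ?_
      rw [hconj n h w hw]
      congr 1
      -- Both `l` and its conjugate by `h` give the action of `N` on the nonzero vector `ρ h v`, so
      -- they agree.
      refine smul_left_injective ℂ hhv ?_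
      simp only
      rw [← hconj n h v hvE, (hmem _).1 hhE n]
    obtain ⟨d, hd⟩ := hvc ⟨h, hst⟩
    rw [hc]
    refine Submodule.smul_mem _ _ ?_
    simp only at hd
    exact hd ▸ Submodule.smul_mem _ _ (Submodule.mem_span_singleton_self v)
  have hle : E ≤ Submodule.span ℂ {v} := fun u hu ↦ hproj.map_id u hu ▸ hPspan u
  exact (Submodule.finrank_mono hle).trans (finrank_span_singleton hv).le

/-- A one-dimensional representation acts through its character. -/
theorem exists_linear_character {G W : Type*} [Group G] [AddCommGroup W] [Module ℂ W]
    (σ : Representation ℂ G W) (h : Module.finrank ℂ W = 1) :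
    ∃ l : G →* ℂˣ, ∀ g, σ.character g = l g := by
  have : Module.Finite ℂ W := Module.finite_of_finrank_eq_succ h
  -- In dimension one the trace equals the determinant, which is multiplicative.
  refine ⟨(LinearMap.det.comp σ).toHomUnits, fun g ↦ ?_⟩
  obtain ⟨c, hc⟩ := (LinearEquiv.smul_id_of_finrank_eq_one h).surjective (σ g)
  replace hc : c • LinearMap.id = σ g := hc
  simp [character, ← hc, h]

end Representation

/-- The scalar product with a linear character is the dimension of its isotypic component. -/
theorem classInner_character_eq_finrank {G : Type u} {V : Type*} [Group G] [Finite G]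
    [AddCommGroup V] [Module ℂ V] [FiniteDimensional ℂ V] (ρ : Representation ℂ G V)
    (l : G →* ℂˣ) :
    classInner ρ.character (fun g ↦ l g) = Module.finrank ℂ (ρ.twistInv l).invariants := by
  have := Fintype.ofFinite G
  have : Invertible (Fintype.card G : ℂ) := invertibleOfNonzero (by simp)
  -- The rank of a projection is its trace.
  rw [← (ρ.twistInv l).isProj_averageMap.trace, Representation.averageMap_eq_sum, map_smul, map_sum,
    classInner, finsum_eq_sum_of_fintype, Nat.card_eq_fintype_card, smul_eq_mul]
  congr 1
  refine Finset.sum_congr rfl fun g _ ↦ ?_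
  have h1 : ‖(l g : ℂ)‖ = 1 := by
    refine Complex.norm_eq_one_of_pow_eq_one (n := Nat.card G) ?_ Nat.card_pos.ne'
    rw [← Units.val_pow_eq_pow_val, ← map_pow, pow_card_eq_one', map_one, Units.val_one]
  have h2 : ρ.twistInv l g = (l g : ℂ)⁻¹ • ρ g := by
    rw [← Units.val_inv_eq_inv_val]
    rfl
  rw [h2, map_smul, ← Complex.inv_eq_conj h1, smul_eq_mul, mul_comm]
  rfl

open scoped ComplexOrder in
/-- A product of a nontrivial abelian normal subgroup and an abelian subgroup is unramified over the
normal one. -/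
theorem isUnramifiedOver_of_mul_comm {G : Type u} [Group G] [Finite G] (N H : Subgroup G)
    (hN : N.Normal) (hbot : N ≠ ⊥) (hNc : ∀ a ∈ N, ∀ b ∈ N, a * b = b * a)
    (hH : ∀ a ∈ H, ∀ b ∈ H, a * b = b * a) (hNH : ∀ g : G, ∃ n ∈ N, ∃ h ∈ H, g = n * h) :
    IsUnramifiedOver G N where
  ne_bot := hbot
  normal := hN
  comm := hNc
  restrict V _ _ _ ρ hρ := by
    refine Or.inl ?_
    rintro _ ⟨W, _, _, _, σ, hσ, rfl⟩
    have : IsMulCommutative N := ⟨⟨fun a b ↦ Subtype.ext (hNc a a.2 b b.2)⟩⟩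
    obtain ⟨l, hl⟩ := σ.exists_linear_character
      (Representation.IsIrreducible.finrank_eq_one_of_isMulCommutative σ)
    rw [funext hl, classInner_character_eq_finrank]
    exact_mod_cast hρ.finrank_invariants_twistInv_le_one N H hH hNH l

theorem isUnramifiedOver_range_inl {A B : Type*} [CommGroup A] [CommGroup B] [Finite A] [Finite B]
    [Nontrivial A] (φ : B →* MulAut A) :
    IsUnramifiedOver (A ⋊[φ] B) (SemidirectProduct.inl : A →* A ⋊[φ] B).range := by
  refine isUnramifiedOver_of_mul_comm _ (SemidirectProduct.inr : B →* A ⋊[φ] B).range ?_ ?_ ?_ ?_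
    fun g ↦ ⟨_, ⟨g.left, rfl⟩, _, ⟨g.right, rfl⟩, (SemidirectProduct.inl_left_mul_inr_right g).symm⟩
  · rw [SemidirectProduct.range_inl_eq_ker_rightHom]
    infer_instance
  · intro h
    obtain ⟨a, ha⟩ := exists_ne (1 : A)
    have h1 : (SemidirectProduct.inl a : A ⋊[φ] B) ∈ (⊥ : Subgroup _) := h ▸ ⟨a, rfl⟩
    exact ha (SemidirectProduct.inl_injective (by simpa using h1))
  · rintro _ ⟨a, rfl⟩ _ ⟨b, rfl⟩
    rw [← map_mul, ← map_mul, mul_comm]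
  · rintro _ ⟨a, rfl⟩ _ ⟨b, rfl⟩
    rw [← map_mul, ← map_mul, mul_comm]

theorem mainTheorem9 {A B : Type*} [CommGroup A] [CommGroup B] [Finite A] [Finite B]
    (φ : B →* MulAut A) :
    IsTotallyUnramified (A ⋊[φ] B) ∧
      (Nontrivial A →
        IsUnramifiedOver (A ⋊[φ] B) (SemidirectProduct.inl : A →* A ⋊[φ] B).range) := by
  refine ⟨?_, fun _ ↦ isUnramifiedOver_range_inl φ⟩
  rcases subsingleton_or_nontrivial A with hA | hA
  · exact .of_comm _ fun x y ↦
      SemidirectProduct.ext (Subsingleton.elim _ _) (mul_comm x.right y.right)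
  · have hu := isUnramifiedOver_range_inl φ
    have := hu.normal
    refine .of_quotient _ _ hu (.of_comm _ fun x y ↦ ?_)
    obtain ⟨x, rfl⟩ := QuotientGroup.mk_surjective x
    obtain ⟨y, rfl⟩ := QuotientGroup.mk_surjective y
    -- Equality in the quotient is tested by `rightHom`, whose target `B` is commutative.
    rw [← QuotientGroup.mk_mul, ← QuotientGroup.mk_mul, QuotientGroup.eq,
      SemidirectProduct.range_inl_eq_ker_rightHom, MonoidHom.mem_ker]
    rw [map_mul, map_inv, map_mul, map_mul, mul_comm, mul_inv_eq_one, mul_comm]
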